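/- Let $m,s,n\ge 1$ and $K\ge 0$ be integers, let $(x_j,y_j)\in\mathbb{R}^m\times\mathbb{R}^s$ $(j=1,\dots,n)$ be observed input--output vectors with $x_j\ge 0$, $x_j\ne 0$, $y_j\ge 0$, $y_j\neq 0$, and let $(r^-_t,r^+_t)\in\mathbb{R}^m\times\mathbb{R}^s$ $(t=1,\dots,K)$ be arbitrary trade-off directions. (Vector inequalities $\le,\ge$ are componentwise, and $>$ between vectors means strict inequality in every component.) Let $$P=\Big\{(x,y)\in\mathbb{R}^m\times\mathbb{R}^s \;\Big|\; \exists \lambda\in\mathbb{R}^n,\ \pi\in\mathbb{R}^K:\ \sum_{j}\lambda_jx_j+\sum_t\pi_t r^-_t\le x,\ \sum_{j}\lambda_jy_j+\sum_t\pi_t r^+_t\ge y,\ \sum_j\lambda_j=1,\ \lambda\ge 0,\ \pi\ge 0\Big\}$$ and let $T=\{(x,y)\in P\mid x\ge 0,\ y\ge 0,\ y\ne 0\}$ (the production possibility set $T_{\mathrm{VRS\text{-}TO}}$). For a set $S\subseteq\mathbb{R}^m\times\mathbb{R}^s$ let $$\partial^s(S)=\{(x,y)\in S\mid (x',y')\notin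 S \text{ whenever } (x,-y)\ge(x',-y'),\ (x,-y)\neq(x',-y')\},$$ $$\partial^w(S)=\{(x,y)\in S\mid (x',y')\notin S \text{ whenever } (x,-y)>(x',-y')\}.$$ For $(x,y)\in T$ define the extended max Russell graph measure $$\hat F(x,y;T)=\max\Big\{\frac{1}{m+s}\Big(\sum_{i=1}^m\theta_i+\sum_{r=1}^s\frac1{\phi_r}\Big)\;\Big|\; \big((\theta_ix_i)_i,(\phi_ry_r)_r\big)\in\partial^s(T),\ 0\le\theta_i\le 1\ (i=1,\dots,m),\ \phi_r\ge 1\ (r=1,\dots,s)\Big\}.$$ Assume that $P\neq\mathbb{R}^m\times\mathbb{R}^s$ and $\partial^s(P)=\partial^w(P)$. Then the maximum defining $\hat F(x,y;T)$ exists for every $(x,y)\in T$ (including points with some zero inputs or outputs), and $\hat F$ has the following two properties. (I) Indication of efficiency: for all $(x,y)\in T$, $\hat F(x,y;T)=1$ if and only if $(x,y)\in\partial^s(T)$. (SM) Strong monotonicity: for all $(x,y),(x',y')\in T$ with $(x,-y)\le(x',-y')$ and $(x,-y)\neq(x',-y')$, one has $\hat F(x,y;T)>\hat F(x',y';T)$.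 -/

import Mathlib

/-- Input--output vectors `(x, y)` with `m` inputs and `s` outputs. -/
abbrev IOVec (m s : ℕ) : Type := (Fin m → ℝ) × (Fin s → ℝ)

/-- The trade-offs polyhedron `P` generated by the observed units `(xd j, yd j)`, `j = 1, …, n`,
and the trade-off directions `(rin t, rout t)`, `t = 1, …, K`.
Vector inequalities are componentwise. -/
def tradeOffPolyhedron {m s n K : ℕ}
    (xd : Fin n → Fin m → ℝ) (yd : Fin n → Fin s → ℝ)
    (rin : Fin K → Fin m → ℝ) (rout : Fin K → Fin s → ℝ) : Set (IOVec m s) :=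
  {p | ∃ (lam : Fin n → ℝ) (mu : Fin K → ℝ),
    (∑ j, lam j • xd j + ∑ t, mu t • rin t ≤ p.1) ∧
    (p.2 ≤ ∑ j, lam j • yd j + ∑ t, mu t • rout t) ∧
    ∑ j, lam j = 1 ∧ (∀ j, 0 ≤ lam j) ∧ (∀ t, 0 ≤ mu t)}

/-- The production possibility set with variable returns to scale and production trade-offs:
the points of `P` with nonnegative inputs and nonnegative, nonzero outputs. -/
def productionSet {m s n K : ℕ}
    (xd : Fin n → Fin m → ℝ) (yd : Fin n → Fin s → ℝ)
    (rin : Fin K → Fin m → ℝ) (rout : Fin K → Fin s → ℝ) : Set (IOVec m s) :=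
  tradeOffPolyhedron xd yd rin rout ∩ {p | 0 ≤ p.1 ∧ 0 ≤ p.2 ∧ p.2 ≠ 0}

/-- `q` dominates `p`: no more of any input, no less of any output, and `q ≠ p`. -/
def Dominates {m s : ℕ} (q p : IOVec m s) : Prop :=
  q.1 ≤ p.1 ∧ p.2 ≤ q.2 ∧ q ≠ p

/-- `q` dominates `p` strictly in every input and every output. -/
def StrictlyDominates {m s : ℕ} (q p : IOVec m s) : Prop :=
  (∀ i, q.1 i < p.1 i) ∧ (∀ r, p.2 r < q.2 r)

/-- The strongly efficient frontier of `T`. -/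
def strongFrontier {m s : ℕ} (T : Set (IOVec m s)) : Set (IOVec m s) :=
  {p | p ∈ T ∧ ∀ q, Dominates q p → q ∉ T}

/-- The weakly efficient frontier of `T`. -/
def weakFrontier {m s : ℕ} (T : Set (IOVec m s)) : Set (IOVec m s) :=
  {p | p ∈ T ∧ ∀ q, StrictlyDominates q p → q ∉ T}

/-- The Russell objective `f (θ, φ) = (∑ θ_i + ∑ 1 / φ_r) / (m + s)`. -/
noncomputable def russellObjective {m s : ℕ} (θ : Fin m → ℝ) (φ : Fin s → ℝ) : ℝ :=
  (1 / ((m : ℝ) + (s : ℝ))) * (∑ i, θ i + ∑ r, 1 / φ r)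

/-- The objective values attained by the feasible `(θ, φ)` of the maximization problem at `p`:
`0 ≤ θ ≤ 1`, `φ ≥ 1`, and the rescaled point `(θ_i x_i, φ_r y_r)` is strongly efficient. -/
def maxRGMValues {m s : ℕ} (T : Set (IOVec m s)) (p : IOVec m s) : Set ℝ :=
  {c | ∃ (θ : Fin m → ℝ) (φ : Fin s → ℝ),
    (∀ i, 0 ≤ θ i ∧ θ i ≤ 1) ∧ (∀ r, 1 ≤ φ r) ∧
    ((fun i => θ i * p.1 i, fun r => φ r * p.2 r) : IOVec m s) ∈ strongFrontier T ∧
    c = russellObjective θ φ}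

/-- The extended max Russell graph measure: the optimal value of the maximization problem. -/
noncomputable def maxRGM {m s : ℕ} (T : Set (IOVec m s)) (p : IOVec m s) : ℝ :=
  sSup (maxRGMValues T p)

/-- Indication of efficiency (I) of a measure `F` on `T`. -/
def Indication {m s : ℕ} (T : Set (IOVec m s)) (F : IOVec m s → ℝ) : Prop :=
  ∀ p ∈ T, F p = 1 ↔ p ∈ strongFrontier T

/-- Strong monotonicity (SM) of a measure `F` on `T`. -/
def StrongMonotonicity {m s : ℕ} (T : Set (IOVec m s)) (F : IOVec m s → ℝ) : Prop :=
  ∀ p ∈ T, ∀ q ∈ T, Dominates q p → F p < F q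

/-! Only five properties of `P` matter: it is closed, convex, freely disposable, proper, and its
weak and strong frontiers coincide. By `mem_strongFrontier_nonnegPart_iff` the targets are the
weakly efficient points of `P` with admissible signs; they form a closed condition and can be
reached along segments. A recession direction dominating zero would carry a strongly efficient point
to a better one, so outputs are bounded once inputs are (`exists_output_bound`). Compactness then
gives the maximum.

For strong monotonicity, let `e` be the optimal target of `p` and let `q` dominate `p`.
`exists_between_mem_weakFrontier` gives a frontier point `g` between `q` and the componentwise
combination of `e` and `q`; the factors carrying `q` to `g` are no worse than those carrying `p` to
`e`. Strictness comes from `g` differing from the combination or, if `g = e`, from `q ≠ p` together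
with the positivity of the optimal factors (`pos_of_maxRGM_eq`). -/

open Set Topology

/-! ### Closedness of finitely generated cones -/

section FiniteCone

variable {ι E : Type*} [Fintype ι] [AddCommGroup E] [Module ℝ E] [TopologicalSpace E]
  [IsTopologicalAddGroup E] [ContinuousSMul ℝ E] [T2Space E]

/-- Conic Carathéodory step: along a nonzero vector of the kernel, a nonnegative coefficient
vector can be moved until a coordinate of the support vanishes. -/
lemma exists_nonneg_sub_smul_eq_zero {c g : ι → ℝ} (hc : 0 ≤ c) {i₀ : ι} (hg : 0 < g i₀) :
    ∃ (t : ℝ) (i : ι), 0 < g i ∧ 0 ≤ c - t • g ∧ (c - t • g) i = 0 := by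
  classical
  obtain ⟨i, hi, hmin⟩ := (Finset.univ.filter fun i => 0 < g i).exists_min_image
    (fun i => c i / g i) ⟨i₀, by simpa using hg⟩
  simp only [Finset.mem_filter, Finset.mem_univ, true_and] at hi hmin
  refine ⟨c i / g i, i, hi, fun k => ?_, ?_⟩
  · have ht : 0 ≤ c i / g i := div_nonneg (hc i) hi.le
    have hk : 0 ≤ c k := hc k
    simp only [Pi.zero_apply, Pi.sub_apply, Pi.smul_apply, smul_eq_mul, sub_nonneg]
    rcases le_or_gt (g k) 0 with h | h
    · exact (mul_nonpos_of_nonneg_of_nonpos ht h).trans hk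
    · exact (le_div_iff₀ h).1 (hmin k h)
  · simp [hi.ne']

/-- The image of a face of the nonnegative orthant under a linear map is closed. -/
lemma isClosed_image_nonneg_face (L : (ι → ℝ) →ₗ[ℝ] E) (s : Finset ι) :
    IsClosed (L '' {c | 0 ≤ c ∧ ∀ i ∉ s, c i = 0}) := by
  classical
  induction s using Finset.strongInduction with
  | H s ih =>
  by_cases hinj : ∃ g : ι → ℝ, (∀ i ∉ s, g i = 0) ∧ L g = 0 ∧ g ≠ 0
  · obtain ⟨g, hgs, hLg, hg0⟩ := hinj
    wlog hpos : ∃ i, 0 < g i generalizing g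
    · refine this (-g) (fun i hi => by simp [hgs i hi]) (by simp [hLg]) (by simpa using hg0) ?_
      obtain ⟨i, hi⟩ := Function.ne_iff.1 hg0
      push Not at hpos
      exact ⟨i, by simpa using lt_of_le_of_ne (hpos i) hi⟩
    obtain ⟨i₀, hi₀⟩ := hpos
    -- Moving along `g` does not change the image, so each image point already comes from a smaller
    -- face.
    have : L '' {c | 0 ≤ c ∧ ∀ i ∉ s, c i = 0} =
        ⋃ i ∈ s, L '' {c | 0 ≤ c ∧ ∀ k ∉ s.erase i, c k = 0} := by
      apply subset_antisymm
      · rintro _ ⟨c, ⟨hc, hcs⟩, rfl⟩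
        obtain ⟨t, i, hi, hnn, hz⟩ := exists_nonneg_sub_smul_eq_zero hc hi₀
        have his : i ∈ s := by
          by_contra h
          exact hi.ne' (hgs i h)
        refine mem_biUnion his ⟨c - t • g, ⟨hnn, fun k hk => ?_⟩, by simp [hLg]⟩
        rcases eq_or_ne k i with rfl | hki
        · exact hz
        · have hks : k ∉ s := fun h => hk (Finset.mem_erase.2 ⟨hki, h⟩)
          simp [hcs k hks, hgs k hks]
      · refine iUnion₂_subset fun i _ => image_mono fun c hc => ⟨hc.1, fun k hk => hc.2 k ?_⟩
        exact fun h => hk (Finset.mem_of_mem_erase h)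
    rw [this]
    exact isClosed_biUnion_finset fun i hi => ih _ (Finset.erase_ssubset hi)
  · push Not at hinj
    let W : Submodule ℝ (ι → ℝ) :=
      { carrier := {c | ∀ i ∉ s, c i = 0}
        add_mem' := fun {a b} ha hb i hi => by simp [ha i hi, hb i hi]
        zero_mem' := fun i _ => rfl
        smul_mem' := fun c a ha i hi => by simp [ha i hi] }
    have hker : LinearMap.ker (L.domRestrict W) = ⊥ := by
      refine (LinearMap.ker_eq_bot').2 fun c hc => Subtype.ext ?_
      exact hinj c.1 c.2 hc
    have hcl := (LinearMap.isClosedEmbedding_of_injective hker).isClosedMap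
      {c : W | 0 ≤ (c : ι → ℝ)} (isClosed_le continuous_const continuous_subtype_val)
    convert hcl using 1
    ext z
    constructor
    · rintro ⟨c, ⟨hc, hcs⟩, rfl⟩
      exact ⟨⟨c, hcs⟩, hc, rfl⟩
    · rintro ⟨c, hc, rfl⟩
      exact ⟨c.1, ⟨hc, c.2⟩, rfl⟩

/-- Finitely generated convex cones are closed. -/
lemma isClosed_image_nonneg (L : (ι → ℝ) →ₗ[ℝ] E) : IsClosed (L '' {c | 0 ≤ c}) := by
  simpa using isClosed_image_nonneg_face L Finset.univ

end FiniteCone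

/-! ### Frontiers and recession directions of a freely disposable set -/

section Technology

variable {m s : ℕ}

/-- Free disposability of inputs and outputs. -/
def FreelyDisposable (S : Set (IOVec m s)) : Prop :=
  ∀ p ∈ S, ∀ q : IOVec m s, p.1 ≤ q.1 → q.2 ≤ p.2 → q ∈ S

/-- The points of `S` with nonnegative inputs and nonnegative nonzero outputs. -/
def nonnegPart (S : Set (IOVec m s)) : Set (IOVec m s) :=
  S ∩ {p | 0 ≤ p.1 ∧ 0 ≤ p.2 ∧ p.2 ≠ 0}

lemma isOpen_strictlyDominates (q : IOVec m s) : IsOpen {p | StrictlyDominates q p} := by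
  have h₁ : IsOpen {p : IOVec m s | ∀ i, q.1 i < p.1 i} := by
    rw [ofPred_forall]
    exact isOpen_iInter_of_finite fun i => isOpen_lt continuous_const (by fun_prop)
  have h₂ : IsOpen {p : IOVec m s | ∀ r, p.2 r < q.2 r} := by
    rw [ofPred_forall]
    exact isOpen_iInter_of_finite fun i => isOpen_lt (by fun_prop) continuous_const
  exact h₁.inter h₂

/-- The points strictly dominated by a given `q` form an open set. This is what makes the feasible
targets compact. -/
lemma isClosed_weakFrontier {S : Set (IOVec m s)} (hS : IsClosed S) :
    IsClosed (weakFrontier S) := by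
  have : weakFrontier S = S ∩ (⋃ q ∈ S, {p | StrictlyDominates q p})ᶜ := by
    ext p
    simp only [weakFrontier, mem_ofPred_eq, mem_inter_iff, mem_compl_iff, mem_iUnion, not_exists]
    exact and_congr_right fun _ => forall_congr' fun q => ⟨fun h hq hd => h hd hq,
      fun h hd hq => h hq hd⟩
  rw [this]
  exact hS.inter (isOpen_biUnion fun q _ => isOpen_strictlyDominates q).isClosed_compl

/-- A segment leaving a closed freely disposable set passes through its weak frontier. -/
lemma exists_lineMap_mem_weakFrontier {S : Set (IOVec m s)} (hS : IsClosed S)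
    (hfd : FreelyDisposable S) {p w : IOVec m s} (hp : p ∈ S) (hw : w ∉ S) :
    ∃ t : ℝ, 0 ≤ t ∧ t < 1 ∧ p + t • (w - p) ∈ weakFrontier S := by
  have hcont : Continuous fun t : ℝ => p + t • (w - p) := by fun_prop
  obtain ⟨t, ⟨⟨ht0, ht1⟩, htS⟩, hmax⟩ :=
    (isCompact_Icc.inter_right (hS.preimage hcont)).exists_isGreatest
      (s := Icc (0 : ℝ) 1 ∩ (fun t : ℝ => p + t • (w - p)) ⁻¹' S)
      ⟨0, ⟨le_rfl, zero_le_one⟩, by simpa using hp⟩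
  have htlt : t < 1 := by
    refine lt_of_le_of_ne ht1 ?_
    rintro rfl
    exact hw (by simpa using htS)
  refine ⟨t, ht0, htlt, htS, fun q hq hqS => ?_⟩
  -- Strict domination persists slightly beyond the last parameter `t` in `S`; disposability then
  -- contradicts maximality.
  have hev : ∀ᶠ u in 𝓝[>] t, StrictlyDominates q (p + u • (w - p)) :=
    (hcont.continuousAt.eventually ((isOpen_strictlyDominates q).mem_nhds hq)).filter_mono
      nhdsWithin_le_nhds
  obtain ⟨u, hqu, htu, hu1⟩ := (hev.and (Ioo_mem_nhdsGT htlt)).exists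
  exact htu.not_ge (hmax ⟨⟨ht0.trans htu.le, hu1.le⟩,
    hfd q hqS _ (fun i => (hqu.1 i).le) fun r => (hqu.2 r).le⟩)

/-- The strongly efficient points of the nonnegative part of a technology are its weakly efficient
points, when weak and strong efficiency agree on the technology. -/
lemma mem_strongFrontier_nonnegPart_iff {S : Set (IOVec m s)} (hfd : FreelyDisposable S)
    (hsw : strongFrontier S = weakFrontier S) {p : IOVec m s} :
    p ∈ strongFrontier (nonnegPart S) ↔ p ∈ weakFrontier S ∧ 0 ≤ p.1 ∧ 0 ≤ p.2 ∧ p.2 ≠ 0 := by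
  constructor
  · rintro ⟨⟨hpS, hp⟩, hdom⟩
    refine ⟨⟨hpS, fun q hq hqS => ?_⟩, hp⟩
    obtain ⟨r, hr⟩ := Function.ne_iff.1 hp.2.2
    have hle : p.2 ≤ q.2 := fun r => (hq.2 r).le
    have hlt : (0 : ℝ) < q.2 r := (hp.2.1 r).trans_lt (hq.2 r)
    -- The inputs of `q` may be negative, so only its outputs are used. Some output exists because
    -- `p.2 ≠ 0`.
    refine hdom (p.1, q.2) ⟨le_rfl, hle, fun h => ?_⟩
      ⟨hfd q hqS _ (fun i => (hq.1 i).le) le_rfl, hp.1, hp.2.1.trans hle, fun h => ?_⟩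
    · exact (hq.2 r).ne (congrFun (congrArg Prod.snd h) r).symm
    · exact hlt.ne' (congrFun h r)
  · rintro ⟨hw, hp⟩
    rw [← hsw] at hw
    exact ⟨⟨hw.1, hp⟩, fun q hq hqT => hw.2 q hq hqT.1⟩

/-- A recession direction of a technology with coinciding frontiers does not dominate zero. -/
lemma not_dominates_zero_of_mem_asymptoticCone {S : Set (IOVec m s)} (hS : IsClosed S)
    (hconv : Convex ℝ S) (hfd : FreelyDisposable S) (hne : S.Nonempty) (huniv : S ≠ univ)
    (hsw : strongFrontier S = weakFrontier S) {d : IOVec m s} (hd : d ∈ asymptoticCone ℝ S) :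
    ¬ Dominates d 0 := by
  rintro ⟨h₁, h₂, h₃⟩
  obtain ⟨p, hp⟩ := hne
  obtain ⟨w, hw⟩ := (ne_univ_iff_exists_notMem S).1 huniv
  obtain ⟨t, -, -, ht⟩ := exists_lineMap_mem_weakFrontier hS hfd hp hw
  rw [← hsw] at ht
  have hmem := hconv.smul_vadd_mem_of_isClosed_of_mem_asymptoticCone hS zero_le_one hd ht.1
  rw [one_smul, vadd_eq_add] at hmem
  refine ht.2 _ ⟨?_, ?_, ?_⟩ hmem
  · exact add_le_of_nonpos_left h₁
  · exact le_add_of_nonneg_left h₂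
  · simpa using h₃

lemma nonneg_of_forall_nonneg_mul_add {a b : ℝ} (h : ∀ c : ℝ, 0 ≤ c → 0 ≤ c * a + b) :
    0 ≤ a := by
  by_contra! ha
  have hb : 0 ≤ b := by simpa using h 0 le_rfl
  -- This multiplier makes `c * a + b` equal to `-1`.
  have := h ((b + 1) / -a) (div_nonneg (by linarith) (by linarith))
  have e : (b + 1) / -a * a = -(b + 1) := by
    rw [div_neg, neg_mul, div_mul_cancel₀ _ ha.ne]
  linarith

/-- Nonnegative outputs producible from bounded nonnegative inputs are bounded. -/
lemma exists_output_bound {S : Set (IOVec m s)} (hS : IsClosed S)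
    (hconv : Convex ℝ S) (hfd : FreelyDisposable S) (huniv : S ≠ univ)
    (hsw : strongFrontier S = weakFrontier S) (x : Fin m → ℝ) :
    ∃ B : ℝ, ∀ p ∈ S, 0 ≤ p.1 → p.1 ≤ x → 0 ≤ p.2 → ∀ r, p.2 r ≤ B := by
  let A : Set (IOVec m s) := S ∩ (Icc 0 x ×ˢ Ici 0)
  have hA : IsClosed A := hS.inter (isClosed_Icc.prod isClosed_Ici)
  have hAc : Convex ℝ A := hconv.inter ((convex_Icc 0 x).prod (convex_Ici 0))
  have hbdd : Bornology.IsBounded A := by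
    rw [isBounded_iff_asymptoticCone_subset_singleton]
    intro d hd
    have hAne : A.Nonempty := asymptoticCone_nonempty.1 ⟨d, hd⟩
    obtain ⟨a, ha⟩ := hAne
    have hray : ∀ c : ℝ, 0 ≤ c → c • d + a ∈ A := fun c hc =>
      hAc.smul_vadd_mem_of_isClosed_of_mem_asymptoticCone hA hc hd ha
    have h₁ : d.1 = 0 := by
      ext i
      apply le_antisymm
      · have : 0 ≤ -d.1 i := nonneg_of_forall_nonneg_mul_add (b := x i - a.1 i) fun c hc => by
          have := (hray c hc).2.1.2 i
          simp only [Prod.fst_add, Prod.smul_fst, Pi.add_apply, Pi.smul_apply,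
            smul_eq_mul] at this
          linarith
        simpa using this
      · exact nonneg_of_forall_nonneg_mul_add fun c hc => (hray c hc).2.1.1 i
    have h₂ : 0 ≤ d.2 := fun r =>
      nonneg_of_forall_nonneg_mul_add fun c hc => (hray c hc).2.2 r
    by_contra hd0
    exact not_dominates_zero_of_mem_asymptoticCone hS hconv hfd ⟨a, ha.1⟩ huniv hsw
      (asymptoticCone_mono inter_subset_left hd) ⟨h₁.le, h₂, hd0⟩
  obtain ⟨B, hB⟩ := hbdd.exists_norm_le
  refine ⟨B, fun p hp h0 h1 h2 r => ?_⟩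
  calc p.2 r ≤ ‖p.2 r‖ := Real.le_norm_self _
    _ ≤ ‖p.2‖ := norm_le_pi_norm _ r
    _ ≤ ‖p‖ := norm_snd_le p
    _ ≤ B := hB p ⟨hp, ⟨h0, h1⟩, h2⟩

end Technology

/-! ### Monotonicity and continuity of the objective -/

section RussellObjective

variable {m s : ℕ}

lemma russellObjective_le {θ θ' : Fin m → ℝ} {φ φ' : Fin s → ℝ} (hθ : θ ≤ θ')
    (hφ' : ∀ r, 1 ≤ φ' r) (hφ : φ' ≤ φ) : russellObjective θ φ ≤ russellObjective θ' φ' := by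
  refine mul_le_mul_of_nonneg_left (add_le_add (Finset.sum_le_sum fun i _ => hθ i)
    (Finset.sum_le_sum fun r _ => ?_)) (by positivity)
  exact one_div_le_one_div_of_le (zero_lt_one.trans_le (hφ' r)) (hφ r)

lemma russellObjective_lt {θ θ' : Fin m → ℝ} {φ φ' : Fin s → ℝ} (hθ : θ ≤ θ')
    (hφ' : ∀ r, 1 ≤ φ' r) (hφ : φ' ≤ φ) (hlt : (∃ i, θ i < θ' i) ∨ ∃ r, φ' r < φ r) :
    russellObjective θ φ < russellObjective θ' φ' := by
  have hpos : 0 < (m : ℝ) + s := by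
    rcases hlt with ⟨i, -⟩ | ⟨r, -⟩
    · have : 0 < m := i.pos
      positivity
    · have : 0 < s := r.pos
      positivity
  have hinv : ∀ r, 1 / φ r ≤ 1 / φ' r := fun r =>
    one_div_le_one_div_of_le (zero_lt_one.trans_le (hφ' r)) (hφ r)
  refine mul_lt_mul_of_pos_left ?_ (by positivity)
  rcases hlt with ⟨i, hi⟩ | ⟨r, hr⟩
  · exact add_lt_add_of_lt_of_le
      (Finset.sum_lt_sum (fun i _ => hθ i) ⟨i, Finset.mem_univ i, hi⟩)
      (Finset.sum_le_sum fun r _ => hinv r)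
  · exact add_lt_add_of_le_of_lt (Finset.sum_le_sum fun i _ => hθ i)
      (Finset.sum_lt_sum (fun r _ => hinv r) ⟨r, Finset.mem_univ r,
        one_div_lt_one_div_of_lt (zero_lt_one.trans_le (hφ' r)) hr⟩)

lemma russellObjective_one (hs : 0 < s) :
    russellObjective (1 : Fin m → ℝ) (1 : Fin s → ℝ) = 1 := by
  have : 0 < (m : ℝ) + s := by positivity
  simp [russellObjective, this.ne']

lemma continuousOn_russellObjective :
    ContinuousOn (fun v : (Fin m → ℝ) × (Fin s → ℝ) => russellObjective v.1 v.2)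
      {v | ∀ r, 1 ≤ v.2 r} := by
  unfold russellObjective
  refine continuousOn_const.mul (ContinuousOn.add (by fun_prop) ?_)
  refine continuousOn_finsetSum _ fun r _ => continuousOn_const.div (by fun_prop) ?_
  exact fun v hv => (zero_lt_one.trans_le (hv r)).ne'

end RussellObjective

/-! ### Attainment, indication and strong monotonicity -/

section Measure

variable {m s : ℕ} {S : Set (IOVec m s)}

/-- Expanding a single positive output up to the frontier is feasible. -/
lemma exists_expand_output (hS : IsClosed S) (hconv : Convex ℝ S) (hfd : FreelyDisposable S)
    (huniv : S ≠ univ) (hsw : strongFrontier S = weakFrontier S) {p : IOVec m s}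
    (hp : p ∈ nonnegPart S) :
    ∃ (r : Fin s) (a : ℝ), 1 ≤ a ∧
      russellObjective (1 : Fin m → ℝ) (Function.update 1 r a : Fin s → ℝ) ∈
        maxRGMValues (nonnegPart S) p := by
  obtain ⟨hpS, hp1, hp2, hp3⟩ := hp
  obtain ⟨r, hr⟩ := Function.ne_iff.1 hp3
  have hrpos : 0 < p.2 r := lt_of_le_of_ne (hp2 r) (Ne.symm hr)
  obtain ⟨B, hB⟩ := exists_output_bound hS hconv hfd huniv hsw p.1
  let b : ℝ := |B| + 1
  have hb : 0 < b := by positivity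
  let w : IOVec m s := (p.1, p.2 + Pi.single r b)
  have hsingle : (0 : Fin s → ℝ) ≤ Pi.single r b := Pi.single_nonneg.2 hb.le
  have hw : w ∉ S := fun h => by
    have h1 := hB w h hp1 le_rfl (add_nonneg hp2 hsingle) r
    have h2 : w.2 r = p.2 r + b := by simp [w]
    have := le_abs_self B
    simp only [h2, b] at h1
    linarith
  obtain ⟨t, ht0, -, ht⟩ := exists_lineMap_mem_weakFrontier hS hfd hpS hw
  have hg : p + t • (w - p) = (p.1, p.2 + t • Pi.single r b) := by
    ext i <;> simp [w]
  rw [hg] at ht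
  have hnn : 0 ≤ t * b / p.2 r := by positivity
  refine ⟨r, 1 + t * b / p.2 r, by linarith, 1, Function.update 1 r (1 + t * b / p.2 r),
    by simp, fun k => ?_, ?_, rfl⟩
  · rcases eq_or_ne k r with rfl | h
    · simpa using hnn
    · simp [h]
  · have hle : p.2 ≤ p.2 + t • Pi.single r b := le_add_of_nonneg_right (smul_nonneg ht0 hsingle)
    convert (mem_strongFrontier_nonnegPart_iff hfd hsw).2 ⟨ht, hp1, hp2.trans hle, fun h =>
      hp3 (le_antisymm (hle.trans h.le) hp2)⟩ using 2
    · ext i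
      simp
    · ext k
      rcases eq_or_ne k r with rfl | h
      · simp only [Function.update_self, Pi.add_apply, Pi.smul_apply, Pi.single_eq_same,
          smul_eq_mul]
        field_simp
      · simp [h]

/-- The maximum defining the measure is attained. -/
lemma isGreatest_maxRGM (hS : IsClosed S) (hconv : Convex ℝ S) (hfd : FreelyDisposable S)
    (huniv : S ≠ univ) (hsw : strongFrontier S = weakFrontier S) {p : IOVec m s}
    (hp : p ∈ nonnegPart S) :
    IsGreatest (maxRGMValues (nonnegPart S) p) (maxRGM (nonnegPart S) p) := by
  classical
  suffices h : ∃ c, IsGreatest (maxRGMValues (nonnegPart S) p) c by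
    obtain ⟨c, hc⟩ := h
    rwa [maxRGM, hc.csSup_eq]
  obtain ⟨hpS, hp1, hp2, hp3⟩ := id hp
  obtain ⟨B, hB⟩ := exists_output_bound hS hconv hfd huniv hsw p.1
  let R : (Fin m → ℝ) × (Fin s → ℝ) → IOVec m s := fun v =>
    (fun i => v.1 i * p.1 i, fun r => v.2 r * p.2 r)
  have hR : Continuous R := by fun_prop
  -- At a zero output, division by zero gives `U r = 1`, which pins that factor to 1.
  let U : Fin s → ℝ := fun r => 1 + |B| / p.2 r
  let C : Set ((Fin m → ℝ) × (Fin s → ℝ)) := (Icc 0 1 ×ˢ Icc 1 U) ∩ R ⁻¹' weakFrontier S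
  have hC : IsCompact C := (isCompact_Icc.prod isCompact_Icc).inter_right
    ((isClosed_weakFrontier hS).preimage hR)
  have hCval : ∀ v ∈ C, russellObjective v.1 v.2 ∈ maxRGMValues (nonnegPart S) p := by
    rintro v ⟨⟨⟨hθ0, hθ1⟩, hφ1, -⟩, hv⟩
    have hle : p.2 ≤ (R v).2 := fun r => le_mul_of_one_le_left (hp2 r) (hφ1 r)
    refine ⟨v.1, v.2, fun i => ⟨hθ0 i, hθ1 i⟩, hφ1, ?_, rfl⟩
    exact (mem_strongFrontier_nonnegPart_iff hfd hsw).2 ⟨hv, fun i => mul_nonneg (hθ0 i) (hp1 i),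
      hp2.trans hle, fun h => hp3 (le_antisymm (hle.trans h.le) hp2)⟩
  have hdom : ∀ c ∈ maxRGMValues (nonnegPart S) p, ∃ v ∈ C, c ≤ russellObjective v.1 v.2 := by
    rintro c ⟨θ, φ, hθ, hφ, hmem, rfl⟩
    obtain ⟨hw, hn1, hn2, -⟩ := (mem_strongFrontier_nonnegPart_iff hfd hsw).1 hmem
    -- Resetting the factors of zero outputs keeps the target and does not lower the objective.
    let φ' : Fin s → ℝ := fun r => if p.2 r = 0 then 1 else φ r
    have hφ' : ∀ r, 1 ≤ φ' r := fun r => by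
      simp only [φ']
      split_ifs
      · exact le_rfl
      · exact hφ r
    have hRe : R (θ, φ') = (fun i => θ i * p.1 i, fun r => φ r * p.2 r) := by
      ext r
      · rfl
      · by_cases h : p.2 r = 0 <;> simp [R, φ', h]
    refine ⟨(θ, φ'), ⟨⟨⟨fun i => (hθ i).1, fun i => (hθ i).2⟩, hφ', fun r => ?_⟩, ?_⟩,
      russellObjective_le le_rfl hφ' fun r => ?_⟩
    · by_cases h : p.2 r = 0
      · simp [φ', U, h]
      · have hpos : 0 < p.2 r := lt_of_le_of_ne (hp2 r) (Ne.symm h)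
        have h1 : φ r * p.2 r ≤ B :=
          hB _ hw.1 hn1 (fun i => mul_le_of_le_one_left (hp1 i) (hθ i).2) hn2 r
        have h2 : φ r ≤ |B| / p.2 r := (le_div_iff₀ hpos).2 (h1.trans (le_abs_self B))
        simp only [φ', U, h, if_false]
        linarith
    · rw [mem_preimage, hRe]
      exact hw
    · simp only [φ']
      split_ifs
      · exact hφ r
      · exact le_rfl
  obtain ⟨r, a, -, hval⟩ := exists_expand_output hS hconv hfd huniv hsw hp
  obtain ⟨v₀, hv₀, -⟩ := hdom _ hval
  obtain ⟨v, hv, hmax⟩ := hC.exists_isMaxOn ⟨v₀, hv₀⟩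
    (continuousOn_russellObjective.mono fun v hv => hv.1.2.1)
  refine ⟨_, hCval v hv, fun c hc => ?_⟩
  obtain ⟨u, hu, hcu⟩ := hdom c hc
  exact hcu.trans (hmax hu)

lemma indication_maxRGM (hS : IsClosed S) (hconv : Convex ℝ S) (hfd : FreelyDisposable S)
    (huniv : S ≠ univ) (hsw : strongFrontier S = weakFrontier S) :
    Indication (nonnegPart S) (maxRGM (nonnegPart S)) := by
  intro p hp
  have hmax := isGreatest_maxRGM hS hconv hfd huniv hsw hp
  have hs : 0 < s := by
    obtain ⟨r, -⟩ := Function.ne_iff.1 hp.2.2.2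
    exact r.pos
  constructor
  · intro h1
    obtain ⟨θ, φ, hθ, hφ, hmem, hval⟩ := hmax.1
    have hno : ¬ ((∃ i, θ i < 1) ∨ ∃ r, 1 < φ r) := fun h => by
      have := russellObjective_lt (θ' := 1) (φ' := 1) (fun i => (hθ i).2) (fun r => le_rfl) hφ h
      rw [russellObjective_one hs, ← hval, h1] at this
      exact lt_irrefl _ this
    push Not at hno
    have e1 : ∀ i, θ i = 1 := fun i => le_antisymm (hθ i).2 (hno.1 i)
    have e2 : ∀ r, φ r = 1 := fun r => le_antisymm (hno.2 r) (hφ r)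
    simpa [e1, e2] using hmem
  · intro hmem
    apply le_antisymm
    · obtain ⟨θ, φ, hθ, hφ, -, hval⟩ := hmax.1
      rw [hval, ← russellObjective_one hs (m := m)]
      exact russellObjective_le (fun i => (hθ i).2) (fun r => le_rfl) hφ
    · refine hmax.2 ⟨1, 1, by simp, by simp, by simpa using hmem, (russellObjective_one hs).symm⟩

/-- Optimal input contraction factors are positive. -/
lemma pos_of_maxRGM_eq (hS : IsClosed S) (hconv : Convex ℝ S) (hfd : FreelyDisposable S)
    (huniv : S ≠ univ) (hsw : strongFrontier S = weakFrontier S) {p : IOVec m s}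
    (hp : p ∈ nonnegPart S) {θ : Fin m → ℝ} {φ : Fin s → ℝ}
    (hθ : ∀ i, 0 ≤ θ i ∧ θ i ≤ 1) (hφ : ∀ r, 1 ≤ φ r)
    (hval : maxRGM (nonnegPart S) p = russellObjective θ φ) (i : Fin m) : 0 < θ i := by
  refine lt_of_le_of_ne (hθ i).1 fun hzero => ?_
  -- With one vanishing input factor the sum is at most `m + s - 1`; expanding a single output gives
  -- `m + s - 1 + 1 / a`, which is larger.
  obtain ⟨r, a, ha, hmem⟩ := exists_expand_output hS hconv hfd huniv hsw hp
  have hle := (isGreatest_maxRGM hS hconv hfd huniv hsw hp).2 hmem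
  rw [hval] at hle
  have hs : 0 < s := r.pos
  have hpos : 0 < (m : ℝ) + s := by positivity
  have hle' := le_of_mul_le_mul_left hle (by positivity : 0 < 1 / ((m : ℝ) + s))
  have hθsum : ∑ k, θ k + 1 ≤ m := by
    have : ∑ k, θ k ≤ ∑ k, Function.update (1 : Fin m → ℝ) i 0 k :=
      Finset.sum_le_sum fun k _ => by
        rcases eq_or_ne k i with rfl | h
        · simp [← hzero]
        · simpa [h] using (hθ k).2
    rw [Finset.sum_update_of_mem (Finset.mem_univ i)] at this
    have hc : ∑ k ∈ Finset.univ \ {i}, (1 : Fin m → ℝ) k + 1 = m := by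
      have := Finset.sum_sdiff (Finset.subset_univ {i}) (f := (1 : Fin m → ℝ))
      simpa using this
    linarith
  have hφsum : ∑ k, 1 / φ k ≤ s := by
    calc ∑ k, 1 / φ k ≤ ∑ _k : Fin s, (1 : ℝ) := Finset.sum_le_sum fun k _ => by
          simpa using inv_le_one_of_one_le₀ (hφ k)
      _ = s := by simp
  have hexp : (s : ℝ) - 1 < ∑ k, 1 / (Function.update 1 r a : Fin s → ℝ) k := by
    have hfun : (fun k => 1 / (Function.update 1 r a : Fin s → ℝ) k) =
        Function.update (1 : Fin s → ℝ) r (1 / a) := by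
      ext k
      rcases eq_or_ne k r with rfl | h
      · simp
      · simp [h]
    rw [hfun, Finset.sum_update_of_mem (Finset.mem_univ r)]
    have hc : ∑ k ∈ Finset.univ \ {r}, (1 : Fin s → ℝ) k + 1 = s := by
      have := Finset.sum_sdiff (Finset.subset_univ {r}) (f := (1 : Fin s → ℝ))
      simpa using this
    have : 0 < 1 / a := by positivity
    linarith
  have hone : ∑ k, (1 : Fin m → ℝ) k = m := by simp
  linarith

/-- Between `q` and the combination of `q` with a frontier point `e` there is a frontier point,
which either is `e` or differs from that combination. -/
lemma exists_between_mem_weakFrontier (hS : IsClosed S) (hfd : FreelyDisposable S)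
    (hsw : strongFrontier S = weakFrontier S) {q e : IOVec m s} (hq : q ∈ S)
    (he : e ∈ weakFrontier S) :
    ∃ g ∈ weakFrontier S, e.1 ⊓ q.1 ≤ g.1 ∧ g.1 ≤ q.1 ∧ q.2 ≤ g.2 ∧ g.2 ≤ e.2 ⊔ q.2 ∧
      (g = e ∨ (∃ i, (e.1 ⊓ q.1) i < g.1 i) ∨ ∃ r, g.2 r < (e.2 ⊔ q.2) r) := by
  let e' : IOVec m s := (e.1 ⊓ q.1, e.2 ⊔ q.2)
  have h₁ : e'.1 ≤ q.1 := inf_le_right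
  have h₂ : q.2 ≤ e'.2 := le_sup_right
  by_cases he' : e' ∈ S
  · have hee : e' = e := by
      by_contra hne
      rw [← hsw] at he
      exact he.2 e' ⟨inf_le_left, le_sup_left, hne⟩ he'
    refine ⟨e, he, inf_le_left, ?_, ?_, le_sup_left, Or.inl rfl⟩
    · rwa [hee] at h₁
    · rwa [hee] at h₂
  · obtain ⟨t, ht0, ht1, hg⟩ := exists_lineMap_mem_weakFrontier hS hfd hq he'
    refine ⟨_, hg, ?_, ?_, ?_, ?_, Or.inr ?_⟩
    · intro i
      have := h₁ i
      change e'.1 i ≤ q.1 i + t * (e'.1 i - q.1 i)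
      nlinarith
    · intro i
      have := h₁ i
      change q.1 i + t * (e'.1 i - q.1 i) ≤ q.1 i
      nlinarith
    · intro r
      have := h₂ r
      change q.2 r ≤ q.2 r + t * (e'.2 r - q.2 r)
      nlinarith
    · intro r
      have := h₂ r
      change q.2 r + t * (e'.2 r - q.2 r) ≤ e'.2 r
      nlinarith
    -- Since `t < 1`, failure of every strict inequality forces `q = e'`, although `e' ∉ S`.
    · by_contra! hno
      apply he'
      convert hq using 1
      refine Prod.ext (funext fun i => ?_) (funext fun r => ?_)
      · have h := hno.1 i
        have := h₁ i
        change q.1 i + t * (e'.1 i - q.1 i) ≤ e'.1 i at h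
        nlinarith
      · have h := hno.2 r
        have := h₂ r
        change e'.2 r ≤ q.2 r + t * (e'.2 r - q.2 r) at h
        nlinarith

lemma strongMonotonicity_maxRGM (hS : IsClosed S) (hconv : Convex ℝ S)
    (hfd : FreelyDisposable S) (huniv : S ≠ univ)
    (hsw : strongFrontier S = weakFrontier S) :
    StrongMonotonicity (nonnegPart S) (maxRGM (nonnegPart S)) := by
  classical
  rintro p hp q hq ⟨hqp1, hpq2, hne⟩
  obtain ⟨θ, φ, hθ, hφ, hmem, hval⟩ := (isGreatest_maxRGM hS hconv hfd huniv hsw hp).1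
  have hθpos := pos_of_maxRGM_eq hS hconv hfd huniv hsw hp hθ hφ hval
  have he := ((mem_strongFrontier_nonnegPart_iff hfd hsw).1 hmem).1
  obtain ⟨hpS, hp1, hp2, hp3⟩ := hp
  obtain ⟨hqS, hq1, hq2, hq3⟩ := id hq
  obtain ⟨g, hg, hg1, hgq1, hqg2, hg2, hstrict⟩ :=
    exists_between_mem_weakFrontier hS hfd hsw hqS he
  have hθq : ∀ i, θ i * q.1 i ≤ ((fun i => θ i * p.1 i) ⊓ q.1) i := fun i =>
    le_min (mul_le_mul_of_nonneg_left (hqp1 i) (hθ i).1) (mul_le_of_le_one_left (hq1 i) (hθ i).2)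
  have hφq : ∀ r, ((fun r => φ r * p.2 r) ⊔ q.2) r ≤ φ r * q.2 r := fun r =>
    max_le (mul_le_mul_of_nonneg_left (hpq2 r) (zero_le_one.trans (hφ r)))
      (le_mul_of_one_le_left (hq2 r) (hφ r))
  have hθg : ∀ i, θ i * q.1 i ≤ g.1 i := fun i => (hθq i).trans (hg1 i)
  have hφg : ∀ r, g.2 r ≤ φ r * q.2 r := fun r => (hg2 r).trans (hφq r)
  have hg0 : ∀ i, 0 ≤ g.1 i := fun i => (mul_nonneg (hθ i).1 (hq1 i)).trans (hθg i)
  -- Where `q` has a zero coordinate so does `g`, hence any factor works there; 1 is the best one.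
  let θ' : Fin m → ℝ := fun i => if q.1 i = 0 then 1 else g.1 i / q.1 i
  let φ' : Fin s → ℝ := fun r => if q.2 r = 0 then 1 else g.2 r / q.2 r
  have hqpos1 : ∀ i, q.1 i ≠ 0 → 0 < q.1 i := fun i h => lt_of_le_of_ne (hq1 i) (Ne.symm h)
  have hqpos2 : ∀ r, q.2 r ≠ 0 → 0 < q.2 r := fun r h => lt_of_le_of_ne (hq2 r) (Ne.symm h)
  have hθ'0 : ∀ i, 0 ≤ θ' i ∧ θ' i ≤ 1 := fun i => by
    by_cases h : q.1 i = 0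
    · simp [θ', h]
    · simp only [θ', h, if_false]
      exact ⟨div_nonneg (hg0 i) (hq1 i), (div_le_one (hqpos1 i h)).2 (hgq1 i)⟩
  have hφ'1 : ∀ r, 1 ≤ φ' r := fun r => by
    by_cases h : q.2 r = 0
    · simp [φ', h]
    · simp only [φ', h, if_false]
      exact (one_le_div (hqpos2 r h)).2 (hqg2 r)
  have hθθ' : θ ≤ θ' := fun i => by
    by_cases h : q.1 i = 0
    · simpa [θ', h] using (hθ i).2
    · simp only [θ', h, if_false]
      exact (le_div_iff₀ (hqpos1 i h)).2 (hθg i)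
  have hφφ' : φ' ≤ φ := fun r => by
    by_cases h : q.2 r = 0
    · simpa [φ', h] using hφ r
    · simp only [φ', h, if_false]
      exact (div_le_iff₀ (hqpos2 r h)).2 (hφg r)
  have hge : ((fun i => θ' i * q.1 i, fun r => φ' r * q.2 r) : IOVec m s) = g := by
    refine Prod.ext (funext fun i => ?_) (funext fun r => ?_)
    · by_cases h : q.1 i = 0
      · have := hgq1 i
        have := hg0 i
        simp only [h, mul_zero]
        linarith
      · simp [θ', h]
    · by_cases h : q.2 r = 0
      · have h1 := hφg r
        have h2 := hqg2 r
        simp only [h, mul_zero] at h1 h2 ⊢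
        linarith
      · simp [φ', h]
  have hval' : russellObjective θ' φ' ∈ maxRGMValues (nonnegPart S) q := by
    refine ⟨θ', φ', hθ'0, hφ'1, ?_, rfl⟩
    rw [hge]
    exact (mem_strongFrontier_nonnegPart_iff hfd hsw).2
      ⟨hg, hg0, hq2.trans hqg2, fun h => hq3 (le_antisymm (hqg2.trans h.le) hq2)⟩
  refine lt_of_lt_of_le ?_ ((isGreatest_maxRGM hS hconv hfd huniv hsw hq).2 hval')
  rw [hval]
  have hlt1 : ∀ i, θ i * q.1 i < g.1 i → θ i < θ' i := fun i hi => by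
    have h : q.1 i ≠ 0 := fun h => by
      have := hgq1 i
      rw [h] at hi this
      linarith
    simp only [θ', h, if_false]
    exact (lt_div_iff₀ (hqpos1 i h)).2 hi
  have hlt2 : ∀ r, g.2 r < φ r * q.2 r → φ' r < φ r := fun r hr => by
    have h : q.2 r ≠ 0 := fun h => by
      have := hqg2 r
      rw [h] at hr this
      linarith
    simp only [φ', h, if_false]
    exact (div_lt_iff₀ (hqpos2 r h)).2 hr
  refine russellObjective_lt hθθ' hφ'1 hφφ' ?_
  rcases hstrict with rfl | ⟨i, hi⟩ | ⟨r, hr⟩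
  · by_contra! hno
    refine hne (Prod.ext (funext fun i => ?_) (funext fun r => ?_))
    · refine le_antisymm (hqp1 i) (not_lt.1 fun h => (hno.1 i).not_gt (hlt1 i ?_))
      exact mul_lt_mul_of_pos_left h (hθpos i)
    · refine le_antisymm (not_lt.1 fun h => (hno.2 r).not_gt (hlt2 r ?_)) (hpq2 r)
      exact mul_lt_mul_of_pos_left h (zero_lt_one.trans_le (hφ r))
  · exact Or.inl ⟨i, hlt1 i ((hθq i).trans_lt hi)⟩
  · exact Or.inr ⟨r, hlt2 r (hr.trans_le (hφq r))⟩

end Measure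

/-! ### The trade-offs polyhedron is closed, convex and freely disposable -/

section Polyhedron

variable {m s n K : ℕ} (xd : Fin n → Fin m → ℝ) (yd : Fin n → Fin s → ℝ)
  (rin : Fin K → Fin m → ℝ) (rout : Fin K → Fin s → ℝ)

lemma freelyDisposable_tradeOffPolyhedron :
    FreelyDisposable (tradeOffPolyhedron xd yd rin rout) := by
  rintro p ⟨lam, mu, h1, h2, h3⟩ q hq1 hq2
  exact ⟨lam, mu, h1.trans hq1, hq2.trans h2, h3⟩

lemma convex_tradeOffPolyhedron : Convex ℝ (tradeOffPolyhedron xd yd rin rout) := by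
  rintro p ⟨l, u, h1, h2, h3, h4, h5⟩ q ⟨l', u', h1', h2', h3', h4', h5'⟩ a b ha hb hab
  have key : ∀ {k : ℕ} (v : Fin n → Fin k → ℝ) (w : Fin K → Fin k → ℝ),
      ∑ j, (a • l + b • l') j • v j + ∑ t, (a • u + b • u') t • w t =
        a • (∑ j, l j • v j + ∑ t, u t • w t) + b • (∑ j, l' j • v j + ∑ t, u' t • w t) := by
    intro k v w
    simp only [Pi.add_apply, Pi.smul_apply, smul_eq_mul, add_smul, mul_smul,
      Finset.sum_add_distrib, smul_add, Finset.smul_sum]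
    abel
  refine ⟨a • l + b • l', a • u + b • u', ?_, ?_, ?_, fun j => ?_, fun t => ?_⟩
  · rw [key]
    exact add_le_add (smul_le_smul_of_nonneg_left h1 ha) (smul_le_smul_of_nonneg_left h1' hb)
  · rw [key]
    exact add_le_add (smul_le_smul_of_nonneg_left h2 ha) (smul_le_smul_of_nonneg_left h2' hb)
  · simp [Finset.sum_add_distrib, ← Finset.mul_sum, h3, h3', hab]
  · exact add_nonneg (mul_nonneg ha (h4 j)) (mul_nonneg hb (h4' j))
  · exact add_nonneg (mul_nonneg ha (h5 t)) (mul_nonneg hb (h5' t))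

/-- The linear map whose image of the nonnegative orthant is the homogenization of the
trade-offs polyhedron. The last two blocks of coordinates are the input and output slacks. -/
noncomputable def homogenizationMap :
    ((Fin n ⊕ Fin K) ⊕ (Fin m ⊕ Fin s) → ℝ) →ₗ[ℝ] IOVec m s × ℝ :=
  Fintype.linearCombination ℝ (Sum.elim
    (Sum.elim (fun j => ((xd j, yd j), 1)) (fun t => ((rin t, rout t), 0)))
    (Sum.elim (fun i => ((Pi.single i 1, 0), 0)) (fun r => ((0, -Pi.single r 1), 0))))

lemma homogenizationMap_apply (c : (Fin n ⊕ Fin K) ⊕ (Fin m ⊕ Fin s) → ℝ) :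
    homogenizationMap xd yd rin rout c =
      ((∑ j, c (.inl (.inl j)) • xd j + ∑ t, c (.inl (.inr t)) • rin t +
          fun i => c (.inr (.inl i)),
        ∑ j, c (.inl (.inl j)) • yd j + ∑ t, c (.inl (.inr t)) • rout t -
          fun r => c (.inr (.inr r))),
        ∑ j, c (.inl (.inl j))) := by
  simp only [homogenizationMap, Fintype.linearCombination_apply, Fintype.sum_sum_type,
    Sum.elim_inl, Sum.elim_inr]
  refine Prod.ext (Prod.ext (funext fun i => ?_) (funext fun r => ?_)) ?_
  · simp [Prod.fst_sum, Pi.single_apply]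
  · simp [Prod.fst_sum, Prod.snd_sum, Pi.single_apply, sub_eq_add_neg]
  · simp [Prod.snd_sum]

/-- The polyhedron is the slice at height 1 of a finitely generated cone, with slack variables
turning the inequalities into equations. -/
lemma isClosed_tradeOffPolyhedron : IsClosed (tradeOffPolyhedron xd yd rin rout) := by
  have hcl := (isClosed_image_nonneg (homogenizationMap xd yd rin rout)).preimage
    (by fun_prop : Continuous fun p : IOVec m s => (p, (1 : ℝ)))
  convert hcl using 1
  ext p
  constructor
  · rintro ⟨l, u, h1, h2, h3, h4, h5⟩
    refine ⟨Sum.elim (Sum.elim l u) (Sum.elim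
      (p.1 - (∑ j, l j • xd j + ∑ t, u t • rin t))
      ((∑ j, l j • yd j + ∑ t, u t • rout t) - p.2)), ?_, ?_⟩
    · rintro ((j | t) | (i | r))
      · exact h4 j
      · exact h5 t
      · exact sub_nonneg.2 (h1 i)
      · exact sub_nonneg.2 (h2 r)
    · rw [homogenizationMap_apply]
      refine Prod.ext (Prod.ext (funext fun i => ?_) (funext fun r => ?_)) ?_
      · simp
      · simp
      · simpa using h3
  · rintro ⟨c, hc, he⟩
    rw [homogenizationMap_apply] at he
    have e1 := congrArg (fun z => z.1.1) he
    have e2 := congrArg (fun z => z.1.2) he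
    have e3 := congrArg (fun z => z.2) he
    simp only at e1 e2 e3
    refine ⟨fun j => c (.inl (.inl j)), fun t => c (.inl (.inr t)), ?_, ?_, e3,
      fun j => hc _, fun t => hc _⟩
    · rw [← e1]
      exact le_add_of_nonneg_right fun i => hc _
    · rw [← e2]
      exact sub_le_self _ fun r => hc _

end Polyhedron

/-- The conclusion also records that the maximum defining the measure is attained on all of the
production set, so that its value is never a convention for an empty or unbounded set. -/
theorem theorem2 {m s n K : ℕ}
    (xd : Fin n → Fin m → ℝ) (yd : Fin n → Fin s → ℝ)
    (rin : Fin K → Fin m → ℝ) (rout : Fin K → Fin s → ℝ)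
    (hxd : ∀ j, 0 ≤ xd j ∧ xd j ≠ 0)
    (hyd : ∀ j, 0 ≤ yd j ∧ yd j ≠ 0)
    (hproper : tradeOffPolyhedron xd yd rin rout ≠ Set.univ)
    (hfrontier : strongFrontier (tradeOffPolyhedron xd yd rin rout) =
      weakFrontier (tradeOffPolyhedron xd yd rin rout)) :
    (∀ p ∈ productionSet xd yd rin rout,
      IsGreatest (maxRGMValues (productionSet xd yd rin rout) p)
        (maxRGM (productionSet xd yd rin rout) p)) ∧
    Indication (productionSet xd yd rin rout) (maxRGM (productionSet xd yd rin rout)) ∧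
    StrongMonotonicity (productionSet xd yd rin rout)
      (maxRGM (productionSet xd yd rin rout)) := by
  have hS := isClosed_tradeOffPolyhedron xd yd rin rout
  have hconv := convex_tradeOffPolyhedron xd yd rin rout
  have hfd := freelyDisposable_tradeOffPolyhedron xd yd rin rout
  exact ⟨fun p hp => isGreatest_maxRGM hS hconv hfd hproper hfrontier hp,
    indication_maxRGM hS hconv hfd hproper hfrontier,
    strongMonotonicity_maxRGM hS hconv hfd hproper hfrontier⟩
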